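/- Let $0<d^-<d^+$ be real numbers and let $(d_j)_{j\ge 1}$ be real numbers with $d^-<d_j<d^+$ for all $j\ge 1$. Define $p_n$ ($n\ge 0$) by $$p(z)=\sum_{n=0}^{\infty}p_nz^n=\exp\Bigl\{\sum_{j=1}^{\infty}\frac{d_j}{j}z^j\Bigr\}.$$ Let $(a_k)_{k\ge 0}$ be complex numbers such that the series $f(z)=\sum_{k=0}^{\infty}a_kz^k$ converges for all complex $z$ with $|z|<1$, and let $A\in\mathbb C$. Then $$\lim_{n\to\infty}\frac1{p_n}\sum_{k=0}^{n}a_kp_{n-k}=A$$ if and only if the following two conditions both hold: 1) $\displaystyle\lim_{x\uparrow 1}f(x)=A$ (with $x$ real); 2) $\displaystyle S(f;n):=\sum_{k=1}^{n}k\,a_k\,p_{n-k}=o(np_n)$ as $n\to\infty$. -/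

import Mathlib

open Filter Topology Asymptotics

noncomputable section

/-- The power series `p(z) = exp (∑_{j ≥ 1} d_j z^j / j)`. The value `d 0` plays no role: the
constant term of the exponent is `d 0 / 0 = 0`. -/
def voronoiGenSeries (d : ℕ → ℝ) : PowerSeries ℝ :=
  (PowerSeries.exp ℝ).subst (PowerSeries.mk fun j : ℕ => d j / (j : ℝ))

/-- The weights `p_n`, i.e. the coefficients in `p(z) = ∑_n p_n z^n`. -/
def voronoiWeight (d : ℕ → ℝ) (n : ℕ) : ℝ :=
  PowerSeries.coeff n (voronoiGenSeries d)

/-- The Voronoi mean `(1 / p_n) ∑_{k=0}^n a_k p_{n-k}`. -/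
def voronoiMean (d : ℕ → ℝ) (a : ℕ → ℂ) (n : ℕ) : ℂ :=
  1 / (voronoiWeight d n : ℂ) *
    ∑ k ∈ Finset.range (n + 1), a k * (voronoiWeight d (n - k) : ℂ)

/-- The sum `S(f; n) = ∑_{k=1}^n a_k k p_{n-k}`, where `f(z) = ∑_k a_k z^k`. -/
def voronoiS (d : ℕ → ℝ) (a : ℕ → ℂ) (n : ℕ) : ℂ :=
  ∑ k ∈ Finset.Icc 1 n, a k * (k : ℂ) * (voronoiWeight d (n - k) : ℂ)

end

/-! Write `m n` for the means, `P(x) = ∑ p_k x^k`, `D(z) = ∑ d_j z^j`. The identity `z p' = D p`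
gives `n p_n = ∑_{k<n} d_{n-k} p_k`, and then `S(f;n) = ∑_{i<n} d_{n-i} p_i (m_n - m_i)`; also `∑
p_k m_k x^k = f(x) P(x)`. If `m` converges, both conditions are averaging statements, because `P(x)`
and `n p_n` tend to infinity.

For the converse, pass to real and imaginary parts and bound `m` and `-m` from above. Given a level
`β`, the deficit `v = (β - m)⁺` satisfies the recurrence as an inequality with error `ε k p_k`.
Hence its weighted partial sums grow at most polynomially beyond `n`, and at `x = 1 - 1/(2n)` the
series `∑ p_k v_k x^k` is controlled by its terms below `n` (`tsum_growth_le`). If `m_n` is close to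
`β` and few earlier means exceed `β`, the size of `S(f;n)` bounds those terms, so `β` cannot be far
above `f(x)` (`sub_le_of_sum_le`). Taking `β = m_n` at a first large value gives boundedness
(`bddAbove_of_isLittleO`); taking `β` just above the limsup gives `limsup_le_of_isLittleO`. -/

/-! ### The recurrence for the weights. -/

/-- Positive weights `p` generated from `d` by the recurrence `n p_n = ∑_{k<n} d_{n-k} p_k`, where
the `d_j` lie between two positive constants. -/
structure IsWeightSystem (d p : ℕ → ℝ) (dm dp : ℝ) : Prop where
  lower_pos : 0 < dm
  lower_le : ∀ j, 1 ≤ j → dm ≤ d j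
  le_upper : ∀ j, 1 ≤ j → d j ≤ dp
  zero : p 0 = 1
  recurrence : ∀ n : ℕ, (n : ℝ) * p n = ∑ k ∈ Finset.range n, d (n - k) * p k

/-- Differentiate the exponential and compare coefficients. -/
theorem isWeightSystem_voronoiWeight {d : ℕ → ℝ} {dm dp : ℝ} (h0 : 0 < dm)
    (hd : ∀ j : ℕ, 1 ≤ j → dm < d j ∧ d j < dp) :
    IsWeightSystem d (voronoiWeight d) dm dp := by
  have hc : PowerSeries.constantCoeff (PowerSeries.mk fun j : ℕ => d j / (j : ℝ)) = 0 := by simp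
  have hs : PowerSeries.HasSubst (PowerSeries.mk fun j : ℕ => d j / (j : ℝ)) :=
    PowerSeries.HasSubst.of_constantCoeff_zero' hc
  refine ⟨h0, fun j hj => (hd j hj).1.le, fun j hj => (hd j hj).2.le, ?_, ?_⟩
  · have h1 : (PowerSeries.exp ℝ) = (PowerSeries.exp ℝ - 1) + 1 := by ring
    have h2 : PowerSeries.constantCoeff ((PowerSeries.exp ℝ - 1).subst
        (PowerSeries.mk fun j : ℕ => d j / (j : ℝ))) = 0 :=
      PowerSeries.constantCoeff_subst_eq_zero hc _ (by simp)
    have h3 : (1 : PowerSeries ℝ).subst (PowerSeries.mk fun j : ℕ => d j / (j : ℝ))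
        = (1 : PowerSeries ℝ) := by
      rw [← PowerSeries.coe_substAlgHom hs, map_one]
    rw [voronoiWeight, voronoiGenSeries, h1, PowerSeries.subst_add hs, h3,
      PowerSeries.coeff_zero_eq_constantCoeff_apply, map_add]
    rw [h2]; simp
  · intro n
    cases n with
    | zero => simp
    | succ n =>
      have key := congrArg (PowerSeries.coeff n)
        (PowerSeries.derivative_subst (f := PowerSeries.exp ℝ) hs)
      rw [PowerSeries.derivative_exp, PowerSeries.coeff_derivative, PowerSeries.coeff_mul,
        Finset.Nat.sum_antidiagonal_eq_sum_range_succ_mk] at key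
      simp only [voronoiWeight, voronoiGenSeries]
      push_cast
      rw [mul_comm, key]
      refine Finset.sum_congr rfl fun k hk => ?_
      have hk' : k ≤ n := Nat.lt_succ_iff.mp (Finset.mem_range.mp hk)
      rw [PowerSeries.coeff_derivative, PowerSeries.coeff_mk, Nat.sub_add_comm hk', mul_comm]
      congr 1
      have : ((n - k : ℕ) : ℝ) + 1 ≠ 0 := by positivity
      push_cast
      field_simp

/-! ### Growth of weights and of solutions of the recurrence inequality. -/

namespace IsWeightSystem

variable {d p : ℕ → ℝ} {dm dp : ℝ}

theorem pos (h : IsWeightSystem d p dm dp) (n : ℕ) : 0 < p n := by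
  induction n using Nat.strong_induction_on with
  | _ n ih =>
    rcases Nat.eq_zero_or_pos n with rfl | hn
    · simp [h.zero]
    · have hs : 0 < (n : ℝ) * p n := by
        rw [h.recurrence]
        refine Finset.sum_pos (fun k hk => ?_) ⟨0, by simpa using hn⟩
        have hk := Finset.mem_range.mp hk
        exact mul_pos (h.lower_pos.trans_le (h.lower_le _ (by omega))) (ih k hk)
      exact pos_of_mul_pos_right hs (by positivity)

theorem upper_pos (h : IsWeightSystem d p dm dp) : 0 < dp :=
  h.lower_pos.trans_le ((h.lower_le 1 le_rfl).trans (h.le_upper 1 le_rfl))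

theorem sum_mul_le (h : IsWeightSystem d p dm dp) {v : ℕ → ℝ} (n : ℕ) (hv : ∀ k < n, 0 ≤ v k) :
    ∑ k ∈ Finset.range n, d (n - k) * (p k * v k) ≤ dp * ∑ k ∈ Finset.range n, p k * v k := by
  rw [Finset.mul_sum]
  refine Finset.sum_le_sum fun k hk => ?_
  have hk := Finset.mem_range.mp hk
  exact mul_le_mul_of_nonneg_right (h.le_upper _ (by omega)) (mul_nonneg (h.pos k).le (hv k hk))

theorem le_sum_mul (h : IsWeightSystem d p dm dp) {v : ℕ → ℝ} (n : ℕ) (hv : ∀ k < n, 0 ≤ v k) :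
    dm * ∑ k ∈ Finset.range n, p k * v k ≤ ∑ k ∈ Finset.range n, d (n - k) * (p k * v k) := by
  rw [Finset.mul_sum]
  refine Finset.sum_le_sum fun k hk => ?_
  have hk := Finset.mem_range.mp hk
  exact mul_le_mul_of_nonneg_right (h.lower_le _ (by omega)) (mul_nonneg (h.pos k).le (hv k hk))

theorem mul_le_sum (h : IsWeightSystem d p dm dp) (n : ℕ) :
    n * p n ≤ dp * ∑ k ∈ Finset.range n, p k := by
  simpa [← h.recurrence] using h.sum_mul_le (v := fun _ => 1) n (by simp)

theorem sum_le_mul (h : IsWeightSystem d p dm dp) (n : ℕ) :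
    dm * ∑ k ∈ Finset.range n, p k ≤ n * p n := by
  simpa [← h.recurrence] using h.le_sum_mul (v := fun _ => 1) n (by simp)

theorem one_le_sum (h : IsWeightSystem d p dm dp) {n : ℕ} (hn : 1 ≤ n) :
    1 ≤ ∑ k ∈ Finset.range n, p k := by
  rw [← h.zero]
  exact Finset.single_le_sum (f := p) (fun k _ => (h.pos k).le) (Finset.mem_range.mpr hn)

/-- Since the partial sums are at least 1, `p (k + 1) ≥ dm / (k + 1)`, and the harmonic series
diverges. -/
theorem tendsto_sum (h : IsWeightSystem d p dm dp) :
    Tendsto (fun n => ∑ k ∈ Finset.range n, p k) atTop atTop := by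
  have h1 := (Real.tendsto_sum_range_one_div_nat_succ_atTop.const_mul_atTop h.lower_pos)
  have h2 := tendsto_atTop_mono (g := fun n => ∑ k ∈ Finset.range n, p (k + 1)) (fun n => by
    rw [Finset.mul_sum]
    refine Finset.sum_le_sum fun k _ => ?_
    have h3 := h.sum_le_mul (k + 1)
    have h4 := mul_le_mul_of_nonneg_left (h.one_le_sum (Nat.le_add_left 1 k)) h.lower_pos.le
    rw [mul_one_div, div_le_iff₀ (by positivity)]
    push_cast at h3
    linarith) h1
  refine (tendsto_add_atTop_iff_nat 1).mp (tendsto_atTop_mono (fun n => ?_) h2)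
  rw [Finset.sum_range_succ' p n]
  linarith [h.pos 0]

theorem tendsto_mul (h : IsWeightSystem d p dm dp) :
    Tendsto (fun n : ℕ => n * p n) atTop atTop :=
  tendsto_atTop_mono h.sum_le_mul (h.tendsto_sum.const_mul_atTop h.lower_pos)

/-- The 2 in `2 * dp` pays for `ε` twice: once as the error in `hk`, once as the shift of `v`. -/
theorem growth_step (h : IsWeightSystem d p dm dp) {v : ℕ → ℝ} {ε : ℝ} {e k : ℕ}
    (he : 2 * dp ≤ e + 1) (hv : ∀ k, 0 ≤ v k) (hε : 0 ≤ ε)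
    (hk : k * (p k * v k) ≤ ∑ i ∈ Finset.range k, d (k - i) * (p i * v i) + ε * (k * p k)) :
    k * (p k * (v k + ε)) ≤ (e + 1) * ∑ i ∈ Finset.range k, p i * (v i + ε) := by
  have h1 := h.sum_mul_le k fun i _ => hv i
  have h2 := mul_le_mul_of_nonneg_left (h.mul_le_sum k) hε
  have h3 : 0 ≤ ∑ i ∈ Finset.range k, p i * v i :=
    Finset.sum_nonneg fun i _ => mul_nonneg (h.pos i).le (hv i)
  have h4 : 0 ≤ ∑ i ∈ Finset.range k, p i := Finset.sum_nonneg fun i _ => (h.pos i).le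
  have h5 : ∑ i ∈ Finset.range k, p i * (v i + ε)
      = ∑ i ∈ Finset.range k, p i * v i + ε * ∑ i ∈ Finset.range k, p i := by
    rw [Finset.mul_sum, ← Finset.sum_add_distrib]
    exact Finset.sum_congr rfl fun i _ => by ring
  have h6 : 0 ≤ ∑ i ∈ Finset.range k, p i * (v i + ε) := by rw [h5]; positivity
  have h7 := mul_le_mul_of_nonneg_right he h6
  have h8 := mul_nonneg h.upper_pos.le h3
  rw [h5] at h7 ⊢
  linarith

/-- By `growth_step` the partial sums grow by a factor of at most `1 + (e + 1) / k`, which is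
exactly the growth factor of `(k + e).choose (e + 1)`. -/
theorem growth (h : IsWeightSystem d p dm dp) {v : ℕ → ℝ} {ε : ℝ} {e n : ℕ}
    (he : 2 * dp ≤ e + 1) (hv : ∀ k, 0 ≤ v k) (hε : 0 ≤ ε) (hn : 1 ≤ n)
    (hrec : ∀ k, n ≤ k →
      k * (p k * v k) ≤ ∑ i ∈ Finset.range k, d (k - i) * (p i * v i) + ε * (k * p k))
    {k : ℕ} (hk : n ≤ k) :
    (∑ i ∈ Finset.range k, p i * (v i + ε)) * ((n + e).choose (e + 1) : ℝ)
      ≤ (∑ i ∈ Finset.range n, p i * (v i + ε)) * ((k + e).choose (e + 1) : ℝ) := by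
  induction k, hk using Nat.le_induction with
  | base => exact le_rfl
  | succ k hk ih =>
    have hk0 : (0 : ℝ) < k := by exact_mod_cast (by omega : 0 < k)
    have h1 := h.growth_step he hv hε (hrec k hk)
    have h2 : ((k + e).choose (e + 1) : ℝ) * (k + e + 1)
        = ((k + 1 + e).choose (e + 1) : ℝ) * k := by
      have := Nat.choose_mul_succ_eq (k + e) (e + 1)
      rw [show k + e + 1 - (e + 1) = k by omega, show k + e + 1 = k + 1 + e by omega] at this
      have h3 : (((k + e).choose (e + 1) * (k + 1 + e) : ℕ) : ℝ)
        = (((k + 1 + e).choose (e + 1) * k : ℕ) : ℝ) := by rw [this]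
      push_cast at h3
      linarith
    rw [Finset.sum_range_succ]
    refine le_of_mul_le_mul_left ?_ hk0
    have h4 := mul_le_mul_of_nonneg_left ih (by positivity : (0 : ℝ) ≤ k + e + 1)
    have h5 := mul_le_mul_of_nonneg_right h1
      (by positivity : (0 : ℝ) ≤ ((n + e).choose (e + 1) : ℝ))
    set H := ∑ i ∈ Finset.range n, p i * (v i + ε)
    have h6 : (k : ℝ) * (H * ((k + 1 + e).choose (e + 1) : ℝ))
        = (k + e + 1) * (H * ((k + e).choose (e + 1) : ℝ)) := by linear_combination -H * h2
    rw [h6]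
    linarith

theorem growth_term (h : IsWeightSystem d p dm dp) {v : ℕ → ℝ} {ε : ℝ} {e n : ℕ}
    (he : 2 * dp ≤ e + 1) (hv : ∀ k, 0 ≤ v k) (hε : 0 ≤ ε) (hn : 1 ≤ n)
    (hrec : ∀ k, n ≤ k →
      k * (p k * v k) ≤ ∑ i ∈ Finset.range k, d (k - i) * (p i * v i) + ε * (k * p k))
    {k : ℕ} (hk : n ≤ k) :
    p k * (v k + ε) * ((n + e).choose (e + 1) : ℝ)
      ≤ (∑ i ∈ Finset.range n, p i * (v i + ε)) * ((k + e).choose e : ℝ) := by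
  have hk0 : (0 : ℝ) < k := by exact_mod_cast (by omega : 0 < k)
  have h1 := mul_le_mul_of_nonneg_right (h.growth_step he hv hε (hrec k hk))
    (by positivity : (0 : ℝ) ≤ ((n + e).choose (e + 1) : ℝ))
  have h2 := mul_le_mul_of_nonneg_left (h.growth he hv hε hn hrec hk)
    (by positivity : (0 : ℝ) ≤ e + 1)
  have h3 : ((k + e).choose (e + 1) : ℝ) * (e + 1) = ((k + e).choose e : ℝ) * k := by
    have := Nat.choose_succ_right_eq (k + e) e
    rw [Nat.add_sub_cancel] at this
    exact_mod_cast this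
  refine le_of_mul_le_mul_left ?_ hk0
  set H := ∑ i ∈ Finset.range n, p i * (v i + ε)
  have h4 : (k : ℝ) * (H * ((k + e).choose e : ℝ))
      = (e + 1) * (H * ((k + e).choose (e + 1) : ℝ)) := by linear_combination -H * h3
  rw [h4]
  linarith

theorem exists_exponent (dp : ℝ) : ∃ e : ℕ, 2 * dp ≤ e + 1 := by
  obtain ⟨e, he⟩ := exists_nat_ge (2 * dp)
  exact ⟨e, by linarith⟩

theorem summable (h : IsWeightSystem d p dm dp) {x : ℝ} (hx0 : 0 ≤ x) (hx1 : x < 1) :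
    Summable fun k => p k * x ^ k := by
  obtain ⟨e, he⟩ := exists_exponent dp
  have hx : ‖x‖ < 1 := by rwa [Real.norm_of_nonneg hx0]
  have hs := summable_choose_mul_geometric_of_norm_lt_one e hx
  -- With `v = 0` and `ε = 1`, the growth bound makes `p` polynomially bounded; it starts at `n =
  -- 1`, so the term `k = 0` is split off.
  refine (summable_nat_add_iff 1).mp (Summable.of_nonneg_of_le (fun k =>
    mul_nonneg (h.pos _).le (by positivity)) (fun k => ?_) ((summable_nat_add_iff 1).mpr hs))
  have := h.growth_term (v := 0) (ε := 1) (n := 1) he (by simp) zero_le_one le_rfl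
    (fun k hk => by simpa using mul_nonneg (Nat.cast_nonneg k) (h.pos k).le)
    (Nat.le_add_left 1 k)
  refine mul_le_mul_of_nonneg_right ?_ (by positivity)
  simpa [h.zero, add_comm 1 e] using this

/-- The point at which the generating function is compared with the `n`-th mean. -/
theorem sub_inv_mem {n : ℕ} (hn : 1 ≤ n) :
    0 ≤ 1 - 1 / (2 * (n : ℝ)) ∧ 1 - 1 / (2 * (n : ℝ)) < 1 := by
  have : (1 : ℝ) ≤ n := by exact_mod_cast hn
  refine ⟨?_, by linarith [show 0 < 1 / (2 * (n : ℝ)) by positivity]⟩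
  rw [sub_nonneg, div_le_one (by positivity)]
  linarith

theorem sum_le_tsum (h : IsWeightSystem d p dm dp) {n : ℕ} (hn : 1 ≤ n) :
    ∑ k ∈ Finset.range n, p k ≤ 2 * ∑' k, p k * (1 - 1 / (2 * (n : ℝ))) ^ k := by
  obtain ⟨hx0, hx1⟩ := sub_inv_mem hn
  have hn0 : (1 : ℝ) ≤ n := by exact_mod_cast hn
  -- Bernoulli's inequality.
  have hb : (1 : ℝ) / 2 ≤ (1 - 1 / (2 * (n : ℝ))) ^ n := by
    have := one_add_mul_le_pow (a := -(1 / (2 * (n : ℝ)))) (by linarith) n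
    rw [← sub_eq_add_neg] at this
    refine le_trans (le_of_eq ?_) this
    field_simp
    norm_num
  set x := 1 - 1 / (2 * (n : ℝ))
  refine le_trans ?_ (mul_le_mul_of_nonneg_left ((h.summable hx0 hx1).sum_le_tsum
    (Finset.range n) fun k _ => mul_nonneg (h.pos k).le (by positivity)) zero_le_two)
  rw [Finset.mul_sum]
  refine Finset.sum_le_sum fun k hk => ?_
  have hk := Finset.mem_range.mp hk
  have h1 : (1 : ℝ) / 2 ≤ x ^ k := hb.trans (pow_le_pow_of_le_one hx0 hx1.le hk.le)
  nlinarith [h.pos k]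

/-- The tail is dominated by `H / b * ∑ (k + e).choose e * x ^ k = H / b * (2 * n) ^ (e + 1)`, and
`b ≥ n ^ (e + 1) / (e + 1)!`, so the constant does not depend on `n`. -/
theorem tsum_growth_le (h : IsWeightSystem d p dm dp) {v : ℕ → ℝ} {ε : ℝ} {e n : ℕ}
    (he : 2 * dp ≤ e + 1) (hv : ∀ k, 0 ≤ v k) (hε : 0 ≤ ε) (hn : 1 ≤ n)
    (hrec : ∀ k, n ≤ k →
      k * (p k * v k) ≤ ∑ i ∈ Finset.range k, d (k - i) * (p i * v i) + ε * (k * p k)) :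
    Summable (fun k => p k * v k * (1 - 1 / (2 * (n : ℝ))) ^ k) ∧
    ∑' k, p k * v k * (1 - 1 / (2 * (n : ℝ))) ^ k
      ≤ (1 + 2 ^ (e + 1) * (e + 1).factorial) * ∑ i ∈ Finset.range n, p i * (v i + ε) := by
  obtain ⟨hx0, hx1⟩ := sub_inv_mem hn
  have hn0 : (1 : ℝ) ≤ n := by exact_mod_cast hn
  have hx2 : 1 - (1 - 1 / (2 * (n : ℝ))) = 1 / (2 * n) := by ring
  set x := 1 - 1 / (2 * (n : ℝ)) with hx
  have hxn : ‖x‖ < 1 := by rwa [Real.norm_of_nonneg hx0]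
  set H := ∑ i ∈ Finset.range n, p i * (v i + ε) with hH
  have hpv : ∀ k, 0 ≤ p k * v k := fun k => mul_nonneg (h.pos k).le (hv k)
  have hH0 : 0 ≤ H := Finset.sum_nonneg fun i _ => mul_nonneg (h.pos i).le (add_nonneg (hv i) hε)
  set b : ℝ := ((n + e).choose (e + 1) : ℝ) with hb
  have hb0 : 0 < b := by
    rw [hb]; exact_mod_cast Nat.choose_pos (by omega)
  have hterm : ∀ k, n ≤ k → p k * v k ≤ H / b * ((k + e).choose e : ℝ) := fun k hk => by
    have h1 := h.growth_term he hv hε hn hrec hk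
    rw [div_mul_eq_mul_div, le_div_iff₀ hb0]
    refine le_trans (mul_le_mul_of_nonneg_right ?_ hb0.le) h1
    exact mul_le_mul_of_nonneg_left (by linarith) (h.pos k).le
  have hs := (hasSum_choose_mul_geometric_of_norm_lt_one e hxn).mul_left (H / b)
  have htail : ∀ k, p (k + n) * v (k + n) * x ^ (k + n)
      ≤ H / b * (((k + n + e).choose e : ℝ) * x ^ (k + n)) := fun k => by
    rw [← mul_assoc]
    exact mul_le_mul_of_nonneg_right (hterm _ (by omega)) (by positivity)
  have hs' := (summable_nat_add_iff n).mpr hs.summable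
  have hsum : Summable fun k => p k * v k * x ^ k :=
    (summable_nat_add_iff n).mp (Summable.of_nonneg_of_le
      (fun k => mul_nonneg (hpv _) (by positivity)) htail hs')
  refine ⟨hsum, ?_⟩
  rw [← hsum.sum_add_tsum_nat_add n]
  have h1 : ∑ k ∈ Finset.range n, p k * v k * x ^ k ≤ H := by
    refine Finset.sum_le_sum fun k _ => ?_
    refine (mul_le_of_le_one_right (hpv k) (pow_le_one₀ hx0 hx1.le)).trans ?_
    exact mul_le_mul_of_nonneg_left (by linarith) (h.pos k).le
  have h2 : ∑' k, p (k + n) * v (k + n) * x ^ (k + n) ≤ H / b * (2 * n) ^ (e + 1) := by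
    refine (((summable_nat_add_iff n).mpr hsum).tsum_le_tsum htail hs').trans ?_
    have h3 := hs.summable.sum_add_tsum_nat_add n
    have h4 : 0 ≤ ∑ k ∈ Finset.range n, H / b * (((k + e).choose e : ℝ) * x ^ k) :=
      Finset.sum_nonneg fun k _ => by positivity
    rw [hs.tsum_eq, hx2, one_div_pow, one_div_one_div] at h3
    linarith
  have h3 : (n : ℝ) ^ (e + 1) ≤ (e + 1).factorial * b := by
    have h5 := Nat.pow_succ_le_ascFactorial n (e + 1)
    rw [Nat.ascFactorial_eq_factorial_mul_choose', ← add_assoc, Nat.add_sub_cancel] at h5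
    rw [hb]; exact_mod_cast h5
  have h4 : H / b * (2 * n) ^ (e + 1) ≤ 2 ^ (e + 1) * (e + 1).factorial * H := by
    rw [div_mul_eq_mul_div, div_le_iff₀ hb0, mul_pow]
    have := mul_le_mul_of_nonneg_left h3 (by positivity : 0 ≤ H * 2 ^ (e + 1))
    linarith
  linarith

end IsWeightSystem

/-! ### The one-sided Tauberian argument for real means. -/

namespace IsWeightSystem

variable {d p : ℕ → ℝ} {dm dp : ℝ}

/-- The positive part of `β - m` inherits the recurrence inequality, since truncation only increases
the right-hand sum; its power series dominates `(β - F) P(x)`. -/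
theorem sub_mul_sum_le (h : IsWeightSystem d p dm dp) {m : ℕ → ℝ} {F β ε : ℝ} {e n : ℕ}
    (he : 2 * dp ≤ e + 1) (hε : 0 ≤ ε) (hn : 1 ≤ n)
    (hF : HasSum (fun k => p k * m k * (1 - 1 / (2 * (n : ℝ))) ^ k)
      (F * ∑' k, p k * (1 - 1 / (2 * (n : ℝ))) ^ k))
    (hrec : ∀ k, n ≤ k →
      ∑ i ∈ Finset.range k, d (k - i) * (p i * m i) - ε * (k * p k) ≤ k * (p k * m k)) :
    (β - F) * ∑ k ∈ Finset.range n, p k ≤ 2 * (1 + 2 ^ (e + 1) * (e + 1).factorial) *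
      ∑ i ∈ Finset.range n, p i * (max (β - m i) 0 + ε) := by
  have hv : ∀ k, 0 ≤ max (β - m k) 0 := fun k => le_max_right _ _
  have hrv : ∀ k, n ≤ k → k * (p k * max (β - m k) 0)
      ≤ ∑ i ∈ Finset.range k, d (k - i) * (p i * max (β - m i) 0) + ε * (k * p k) := fun k hk => by
    have h0 : 0 ≤ ∑ i ∈ Finset.range k, d (k - i) * (p i * max (β - m i) 0) :=
      le_trans (mul_nonneg h.lower_pos.le
        (Finset.sum_nonneg fun i _ => mul_nonneg (h.pos i).le (hv i))) (h.le_sum_mul k fun i _ => hv i)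
    have h1 : 0 ≤ ε * (k * p k) := mul_nonneg hε (mul_nonneg (Nat.cast_nonneg k) (h.pos k).le)
    rcases le_total (β - m k) 0 with h2 | h2
    · rw [max_eq_right h2, mul_zero, mul_zero]; linarith
    · rw [max_eq_left h2]
      have h3 : ∑ i ∈ Finset.range k, d (k - i) * (p i * (β - m i))
          ≤ ∑ i ∈ Finset.range k, d (k - i) * (p i * max (β - m i) 0) := by
        refine Finset.sum_le_sum fun i hi => ?_
        have hi := Finset.mem_range.mp hi
        exact mul_le_mul_of_nonneg_left (mul_le_mul_of_nonneg_left (le_max_left _ _) (h.pos i).le)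
          (h.lower_pos.le.trans (h.lower_le _ (by omega)))
      have h4 : ∑ i ∈ Finset.range k, d (k - i) * (p i * (β - m i))
          = β * (k * p k) - ∑ i ∈ Finset.range k, d (k - i) * (p i * m i) := by
        rw [h.recurrence, Finset.mul_sum, ← Finset.sum_sub_distrib]
        exact Finset.sum_congr rfl fun i _ => by ring
      linarith [hrec k hk]
  obtain ⟨hs, hle⟩ := h.tsum_growth_le he hv hε hn hrv
  obtain ⟨hx0, hx1⟩ := sub_inv_mem hn
  have hQ := h.sum_le_tsum hn
  have hP := h.summable hx0 hx1
  set x := 1 - 1 / (2 * (n : ℝ))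
  have h5 : (β - F) * ∑' k, p k * x ^ k ≤ ∑' k, p k * max (β - m k) 0 * x ^ k := by
    refine hasSum_le (fun k => ?_) ((hP.hasSum.mul_left β).sub hF) hs.hasSum |>.trans' (le_of_eq ?_)
    · have := mul_le_mul_of_nonneg_right (mul_le_mul_of_nonneg_left (le_max_left (β - m k) 0)
        (h.pos k).le) (pow_nonneg hx0 k)
      linarith
    · ring
  have h6 : 0 ≤ ∑ i ∈ Finset.range n, p i * (max (β - m i) 0 + ε) :=
    Finset.sum_nonneg fun i _ => mul_nonneg (h.pos i).le (add_nonneg (hv i) hε)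
  rcases le_total (β - F) 0 with h7 | h7
  · exact (mul_nonpos_of_nonpos_of_nonneg h7 (zero_le_one.trans (h.one_le_sum hn))).trans
      (by positivity)
  · have := mul_le_mul_of_nonneg_left hQ h7
    linarith

/-- The bounds on `d` make `n * p n` comparable to the partial sum of `p`, which then cancels from
`sub_mul_sum_le`. -/
theorem sub_le_of_sum_le (h : IsWeightSystem d p dm dp) {m : ℕ → ℝ} {F β ε T : ℝ} {e n : ℕ}
    (he : 2 * dp ≤ e + 1) (hε : 0 ≤ ε) (hn : 1 ≤ n) (hT : 0 ≤ T)
    (hF : HasSum (fun k => p k * m k * (1 - 1 / (2 * (n : ℝ))) ^ k)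
      (F * ∑' k, p k * (1 - 1 / (2 * (n : ℝ))) ^ k))
    (hrec : ∀ k, n ≤ k →
      ∑ i ∈ Finset.range k, d (k - i) * (p i * m i) - ε * (k * p k) ≤ k * (p k * m k))
    (hv : ∑ i ∈ Finset.range n, d (n - i) * (p i * max (β - m i) 0) ≤ T * (n * p n)) :
    β - F ≤ 2 * (1 + 2 ^ (e + 1) * (e + 1).factorial) * (T * dp / dm + ε) := by
  have h1 := h.sub_mul_sum_le (β := β) he hε hn hF hrec
  have h2 := (h.le_sum_mul n (v := fun i => max (β - m i) 0) fun i _ => le_max_right _ _).trans hv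
  have h3 := mul_le_mul_of_nonneg_left (h.mul_le_sum n) hT
  have hQ := h.one_le_sum hn
  have hdm := h.lower_pos
  set Q := ∑ k ∈ Finset.range n, p k with hQd
  refine le_of_mul_le_mul_right (h1.trans ?_) (zero_lt_one.trans_le hQ)
  rw [mul_assoc (2 * _) _ Q]
  refine mul_le_mul_of_nonneg_left ?_ (by positivity)
  have h4 : ∑ i ∈ Finset.range n, p i * (max (β - m i) 0 + ε)
      = ∑ i ∈ Finset.range n, p i * max (β - m i) 0 + ε * Q := by
    rw [hQd, Finset.mul_sum, ← Finset.sum_add_distrib]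
    exact Finset.sum_congr rfl fun i _ => by ring
  have h5 : ∑ i ∈ Finset.range n, p i * max (β - m i) 0 ≤ T * dp / dm * Q := by
    rw [div_mul_eq_mul_div, le_div_iff₀ hdm]
    linarith
  rw [h4]
  linarith

theorem tendsto_sub_inv :
    Tendsto (fun n : ℕ => 1 - 1 / (2 * (n : ℝ))) atTop (𝓝[<] 1) := by
  refine tendsto_nhdsWithin_iff.mpr ⟨?_, ?_⟩
  · have h1 : Tendsto (fun n : ℕ => 2 * (n : ℝ)) atTop atTop :=
      tendsto_natCast_atTop_atTop.const_mul_atTop two_pos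
    simpa using h1.inv_tendsto_atTop.const_sub 1
  · filter_upwards [eventually_ge_atTop 1] with n hn using (sub_inv_mem hn).2

theorem bddAbove_of_isLittleO (h : IsWeightSystem d p dm dp) {m : ℕ → ℝ} {F : ℝ → ℝ} {A : ℝ}
    (hsum : ∀ x, 0 ≤ x → x < 1 → HasSum (fun k => p k * m k * x ^ k) (F x * ∑' k, p k * x ^ k))
    (hF : Tendsto F (𝓝[<] 1) (𝓝 A))
    (hs : (fun n : ℕ => n * (p n * m n) - ∑ i ∈ Finset.range n, d (n - i) * (p i * m i))
      =o[atTop] fun n : ℕ => n * p n) :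
    BddAbove (Set.range m) := by
  obtain ⟨e, he⟩ := exists_exponent dp
  obtain ⟨B, hB⟩ := (hF.comp tendsto_sub_inv).bddAbove_range
  -- At `n = 0` the point is `1` by the division convention; only `n ≥ 1` is used below.
  have hB : ∀ n : ℕ, F (1 - 1 / (2 * (n : ℝ))) ≤ B := fun n => hB ⟨n, rfl⟩
  obtain ⟨E, hE⟩ := hs.tendsto_div_nhds_zero.abs.bddAbove_range
  have hE0 : 0 ≤ E := (abs_nonneg _).trans (hE ⟨0, rfl⟩)
  have hE : ∀ n : ℕ,
      |n * (p n * m n) - ∑ i ∈ Finset.range n, d (n - i) * (p i * m i)| ≤ E * (n * p n) := by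
    intro n
    rcases Nat.eq_zero_or_pos n with rfl | hn
    · simp
    · have hnp : 0 < n * p n := mul_pos (by exact_mod_cast hn) (h.pos n)
      have : |_ / _| ≤ E := hE ⟨n, rfl⟩
      rwa [abs_div, abs_of_pos hnp, div_le_iff₀ hnp] at this
  set K := max (m 0) (B + 2 * (1 + 2 ^ (e + 1) * (e + 1).factorial) * (E * dp / dm + E))
  suffices hK : ∀ n, m n ≤ K from ⟨K, by rintro _ ⟨n, rfl⟩; exact hK n⟩
  intro n
  induction n using Nat.strong_induction_on with
  | _ n ih =>
    rcases Nat.eq_zero_or_pos n with rfl | hn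
    · exact le_max_left _ _
    by_contra! hlt
    obtain ⟨hx0, hx1⟩ := sub_inv_mem hn
    -- No earlier mean exceeds `m n`, so for `β = m n` truncation changes nothing and the sum is
    -- `S(f;n)` itself.
    have hmax : ∑ i ∈ Finset.range n, d (n - i) * (p i * max (m n - m i) 0)
        = n * (p n * m n) - ∑ i ∈ Finset.range n, d (n - i) * (p i * m i) := by
      rw [← mul_assoc, h.recurrence, Finset.sum_mul, ← Finset.sum_sub_distrib]
      refine Finset.sum_congr rfl fun i hi => ?_
      rw [max_eq_left (by linarith [ih i (Finset.mem_range.mp hi)])]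
      ring
    have h1 := h.sub_le_of_sum_le he hE0 hn hE0 (hsum _ hx0 hx1)
      (fun k _ => by linarith [neg_abs_le (k * (p k * m k) -
        ∑ i ∈ Finset.range k, d (k - i) * (p i * m i)), hE k])
      (hmax.le.trans ((le_abs_self _).trans (hE n)))
    have h2 : B + 2 * (1 + 2 ^ (e + 1) * (e + 1).factorial) * (E * dp / dm + E) ≤ K :=
      le_max_right _ _
    linarith [hB n]

theorem limsup_le_of_isLittleO (h : IsWeightSystem d p dm dp) {m : ℕ → ℝ} {F : ℝ → ℝ} {A : ℝ}
    (hsum : ∀ x, 0 ≤ x → x < 1 → HasSum (fun k => p k * m k * x ^ k) (F x * ∑' k, p k * x ^ k))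
    (hF : Tendsto F (𝓝[<] 1) (𝓝 A))
    (hs : (fun n : ℕ => n * (p n * m n) - ∑ i ∈ Finset.range n, d (n - i) * (p i * m i))
      =o[atTop] fun n : ℕ => n * p n)
    (hbelow : BddBelow (Set.range m)) :
    limsup m atTop ≤ A := by
  have hab := (h.bddAbove_of_isLittleO hsum hF hs).isBoundedUnder_of_range (f := atTop)
  have hbb := hbelow.isBoundedUnder_of_range (f := atTop)
  obtain ⟨e, he⟩ := exists_exponent dp
  set C : ℝ := 2 * (1 + 2 ^ (e + 1) * (e + 1).factorial) with hC
  have hdm := h.lower_pos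
  have hdp := h.upper_pos
  have hC0 : 0 < C * (4 * dp / dm + 1) := by positivity
  suffices key : ∀ η > 0, limsup m atTop ≤ A + C * (4 * dp / dm + 1) * η by
    refine le_of_forall_pos_le_add fun δ hδ => ?_
    refine (key (δ / (C * (4 * dp / dm + 1))) (by positivity)).trans (le_of_eq ?_)
    rw [mul_div_cancel₀ _ hC0.ne']
  intro η hη
  have e1 : ∀ᶠ n in atTop, m n < limsup m atTop + η :=
    eventually_lt_of_limsup_lt (by linarith) hab
  have e2 : ∃ᶠ n in atTop, limsup m atTop - η < m n :=
    frequently_lt_of_lt_limsup hbb.isCoboundedUnder_le (by linarith)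
  have e3 := hs.def hη
  have e4 : ∀ᶠ n : ℕ in atTop, F (1 - 1 / (2 * (n : ℝ))) < A + η :=
    (hF.comp tendsto_sub_inv).eventually_lt_const (by linarith)
  set β := limsup m atTop + η with hβ
  obtain ⟨N, hN⟩ := eventually_atTop.mp (e1.and e3)
  -- Bounds the contribution of the finitely many early means that may exceed `β`.
  set K := dp * ∑ k ∈ Finset.range N, p k * max (m k - β) 0 with hK
  have e5 : ∀ᶠ n : ℕ in atTop, K ≤ η * (n * p n) :=
    (h.tendsto_mul.const_mul_atTop hη).eventually_ge_atTop K
  obtain ⟨n, hLn, hFn, hKn, hnN⟩ :=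
    (e2.and_eventually (e4.and (e5.and (eventually_ge_atTop (max N 1))))).exists
  have hn1 : 1 ≤ n := le_of_max_le_right hnN
  have hnN : N ≤ n := le_of_max_le_left hnN
  obtain ⟨hx0, hx1⟩ := sub_inv_mem hn1
  have hrec : ∀ k, N ≤ k →
      |k * (p k * m k) - ∑ i ∈ Finset.range k, d (k - i) * (p i * m i)| ≤ η * (k * p k) := by
    intro k hk
    have := (hN k hk).2
    rwa [Real.norm_eq_abs, Real.norm_of_nonneg
      (mul_nonneg (Nat.cast_nonneg k) (h.pos k).le)] at this
  have hw : ∑ i ∈ Finset.range n, p i * max (m i - β) 0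
      = ∑ k ∈ Finset.range N, p k * max (m k - β) 0 := by
    refine (Finset.sum_subset (Finset.range_mono hnN) fun i _ hi => ?_).symm
    rw [Finset.mem_range, not_lt] at hi
    rw [max_eq_right (by linarith [(hN i hi).1]), mul_zero]
  have hw' := h.sum_mul_le n (v := fun i => max (m i - β) 0) fun i _ => le_max_right _ _
  rw [hw, ← hK] at hw'
  have hsplit : ∑ i ∈ Finset.range n, d (n - i) * (p i * max (β - m i) 0)
      = β * (n * p n) - ∑ i ∈ Finset.range n, d (n - i) * (p i * m i)
        + ∑ i ∈ Finset.range n, d (n - i) * (p i * max (m i - β) 0) := by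
    rw [h.recurrence, Finset.mul_sum, ← Finset.sum_sub_distrib, ← Finset.sum_add_distrib]
    refine Finset.sum_congr rfl fun i _ => ?_
    have : max (β - m i) 0 = β - m i + max (m i - β) 0 := by
      rcases le_total (β - m i) 0 with h1 | h1
      · rw [max_eq_right h1, max_eq_left (by linarith)]; ring
      · rw [max_eq_left h1, max_eq_right (by linarith)]; ring
    rw [this]
    ring
  have hnp : 0 < n * p n := mul_pos (by exact_mod_cast hn1) (h.pos n)
  -- Of the `4 * η`, two come from `β - m n < 2 * η`, one from `S(f;n)` and one from `K`.
  have hv : ∑ i ∈ Finset.range n, d (n - i) * (p i * max (β - m i) 0) ≤ 4 * η * (n * p n) := by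
    have h1 := (le_abs_self _).trans (hrec n hnN)
    have h2 : (β - m n) * (n * p n) ≤ 2 * η * (n * p n) :=
      mul_le_mul_of_nonneg_right (by linarith) hnp.le
    rw [hsplit]
    linarith
  have h1 := h.sub_le_of_sum_le he hη.le hn1 (by positivity) (hsum _ hx0 hx1)
    (fun k hk => by linarith [neg_abs_le (k * (p k * m k) -
      ∑ i ∈ Finset.range k, d (k - i) * (p i * m i)), hrec k (hnN.trans hk)]) hv
  have h2 : C * (4 * η * dp / dm + η) = C * (4 * dp / dm + 1) * η := by ring
  rw [← hC, h2] at h1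
  linarith

theorem tendsto_of_isLittleO (h : IsWeightSystem d p dm dp) {m : ℕ → ℝ} {F : ℝ → ℝ} {A : ℝ}
    (hsum : ∀ x, 0 ≤ x → x < 1 → HasSum (fun k => p k * m k * x ^ k) (F x * ∑' k, p k * x ^ k))
    (hF : Tendsto F (𝓝[<] 1) (𝓝 A))
    (hs : (fun n : ℕ => n * (p n * m n) - ∑ i ∈ Finset.range n, d (n - i) * (p i * m i))
      =o[atTop] fun n : ℕ => n * p n) :
    Tendsto m atTop (𝓝 A) := by
  have hsum' : ∀ x, 0 ≤ x → x < 1 →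
      HasSum (fun k => p k * -m k * x ^ k) (-F x * ∑' k, p k * x ^ k) := fun x h0 h1 => by
    simpa using (hsum x h0 h1).neg
  have hs' : (fun n : ℕ => n * (p n * -m n) - ∑ i ∈ Finset.range n, d (n - i) * (p i * -m i))
      =o[atTop] fun n : ℕ => n * p n := by
    refine hs.neg_left.congr_left fun n => ?_
    simp only [mul_neg, Finset.sum_neg_distrib]
    ring
  obtain ⟨B, hB⟩ := h.bddAbove_of_isLittleO hsum hF hs
  obtain ⟨B', hB'⟩ := h.bddAbove_of_isLittleO hsum' hF.neg hs'
  have hlo : BddBelow (Set.range m) :=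
    ⟨-B', by rintro _ ⟨n, rfl⟩; linarith [hB' ⟨n, rfl⟩]⟩
  have hlo' : BddBelow (Set.range fun n => -m n) :=
    ⟨-B, by rintro _ ⟨n, rfl⟩; linarith [hB ⟨n, rfl⟩]⟩
  have h1 := h.limsup_le_of_isLittleO hsum hF hs hlo
  have h2 := h.limsup_le_of_isLittleO hsum' hF.neg hs' hlo'
  refine tendsto_order.mpr ⟨fun a ha => ?_, fun a ha => ?_⟩
  · filter_upwards [eventually_lt_of_limsup_lt (h2.trans_lt (neg_lt_neg ha))
      (BddAbove.isBoundedUnder_of_range ⟨B', hB'⟩)] with n hn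
    linarith
  · exact eventually_lt_of_limsup_lt (h1.trans_lt ha) (BddAbove.isBoundedUnder_of_range ⟨B, hB⟩)

end IsWeightSystem

/-! ### The Abelian direction, and passage to complex means. -/

namespace IsWeightSystem

variable {d p : ℕ → ℝ} {dm dp : ℝ}

theorem tendsto_tsum_atTop (h : IsWeightSystem d p dm dp) :
    Tendsto (fun x : ℝ => ∑' k, p k * x ^ k) (𝓝[<] 1) atTop := by
  refine tendsto_atTop.mpr fun K => ?_
  obtain ⟨N, hN⟩ := (h.tendsto_sum.eventually_gt_atTop K).exists
  have h1 : Tendsto (fun x : ℝ => ∑ k ∈ Finset.range N, p k * x ^ k) (𝓝[<] 1)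
      (𝓝 (∑ k ∈ Finset.range N, p k)) := by
    have hc : Continuous fun x : ℝ => ∑ k ∈ Finset.range N, p k * x ^ k := by fun_prop
    simpa using (hc.tendsto 1).mono_left nhdsWithin_le_nhds
  filter_upwards [h1.eventually_const_lt hN, Ioo_mem_nhdsLT zero_lt_one] with x hx hx1
  exact hx.le.trans ((h.summable hx1.1.le hx1.2).sum_le_tsum _
    fun k _ => mul_nonneg (h.pos k).le (pow_nonneg hx1.1.le k))

/-- A convergent sequence has Abelian means with respect to `p` converging to the same limit. -/
theorem tendsto_of_tendsto_mean (h : IsWeightSystem d p dm dp) {m : ℕ → ℂ} {F : ℝ → ℂ} {A : ℂ}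
    (hsum : ∀ x : ℝ, 0 ≤ x → x < 1 →
      HasSum (fun k => (p k : ℂ) * m k * (x : ℂ) ^ k) (F x * (∑' k, p k * x ^ k : ℝ)))
    (hm : Tendsto m atTop (𝓝 A)) : Tendsto F (𝓝[<] 1) (𝓝 A) := by
  refine Metric.tendsto_nhds.mpr fun ε hε => ?_
  obtain ⟨N, hN⟩ := eventually_atTop.mp (Metric.tendsto_nhds.mp hm (ε / 3) (by positivity))
  set w : ℕ → ℝ := fun k => if k < N then ‖m k - A‖ else 0 with hw
  set K := ∑ k ∈ Finset.range N, p k * ‖m k - A‖ with hK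
  have hmw : ∀ k, ‖m k - A‖ ≤ w k + ε / 3 := fun k => by
    by_cases hk : k < N
    · simp only [hw, if_pos hk]; linarith
    · simp only [hw, if_neg hk]; linarith [hN k (not_lt.mp hk), dist_eq_norm (m k) A]
  filter_upwards [h.tendsto_tsum_atTop.eventually_ge_atTop (max (3 * K / ε) 1),
    Ioo_mem_nhdsLT zero_lt_one] with x hx hx1
  have hP := h.summable hx1.1.le hx1.2
  set P := ∑' k, p k * x ^ k with hPd
  have hP0 : 0 < P := zero_lt_one.trans_le (le_of_max_le_right hx)
  have hKP : K ≤ ε / 3 * P := by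
    have := (div_le_iff₀ hε).mp (le_of_max_le_left hx)
    linarith
  have h1 : HasSum (fun k => (p k : ℂ) * (m k - A) * (x : ℂ) ^ k) ((F x - A) * P) := by
    have h2 := (Complex.hasSum_ofReal.mpr hP.hasSum).mul_left A
    rw [sub_mul]
    convert! ((hsum x hx1.1.le hx1.2).sub h2) using 1
    ext k
    push_cast
    ring
  have h3 : HasSum (fun k => p k * w k * x ^ k) (∑ k ∈ Finset.range N, p k * w k * x ^ k) :=
    hasSum_sum_of_ne_finset_zero fun k hk => by
      rw [Finset.mem_range] at hk
      simp [hw, hk]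
  have h4 := h1.norm_le_of_bounded (h3.add (hP.hasSum.mul_left (ε / 3))) fun k => by
    rw [norm_mul, norm_mul, norm_pow, Complex.norm_real, Complex.norm_real,
      Real.norm_of_nonneg (h.pos k).le, Real.norm_of_nonneg hx1.1.le]
    have := mul_le_mul_of_nonneg_right (mul_le_mul_of_nonneg_left (hmw k) (h.pos k).le)
      (pow_nonneg hx1.1.le k)
    linarith
  have h5 : ∑ k ∈ Finset.range N, p k * w k * x ^ k ≤ K := by
    refine Finset.sum_le_sum fun k hk => ?_
    simp only [hw, if_pos (Finset.mem_range.mp hk)]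
    exact mul_le_of_le_one_right (mul_nonneg (h.pos k).le (norm_nonneg _))
      (pow_le_one₀ hx1.1.le hx1.2.le)
  rw [norm_mul, Complex.norm_real, Real.norm_of_nonneg hP0.le] at h4
  rw [dist_eq_norm]
  refine lt_of_mul_lt_mul_right ?_ hP0.le
  have := mul_pos hε hP0
  linarith

/-- By the recurrence the difference is `∑ d_{n-i} p_i (m_n - m_i)`, whose weights have total `n p_n
→ ∞`; finitely many early terms are negligible. -/
theorem isLittleO_of_tendsto (h : IsWeightSystem d p dm dp) {m : ℕ → ℂ} {A : ℂ}
    (hm : Tendsto m atTop (𝓝 A)) :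
    (fun n : ℕ => (n : ℂ) * ((p n : ℂ) * m n)
        - ∑ i ∈ Finset.range n, (d (n - i) : ℂ) * ((p i : ℂ) * m i))
      =o[atTop] fun n : ℕ => (n : ℝ) * p n := by
  refine isLittleO_iff.mpr fun ε hε => ?_
  obtain ⟨N, hN⟩ := eventually_atTop.mp (Metric.tendsto_nhds.mp hm (ε / 3) (by positivity))
  set w : ℕ → ℝ := fun k => if k < N then ‖m k - A‖ else 0 with hw
  set K := dp * ∑ k ∈ Finset.range N, p k * w k with hK
  have hw0 : ∀ k, 0 ≤ w k := fun k => by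
    simp only [hw]; split_ifs <;> positivity
  have hmw : ∀ k, ‖m k - A‖ ≤ w k + ε / 3 := fun k => by
    by_cases hk : k < N
    · simp only [hw, if_pos hk]; linarith
    · simp only [hw, if_neg hk]; linarith [hN k (not_lt.mp hk), dist_eq_norm (m k) A]
  filter_upwards [eventually_ge_atTop N, (h.tendsto_mul.const_mul_atTop
    (by positivity : 0 < ε / 3)).eventually_ge_atTop K] with n hn hKn
  have hnp : 0 ≤ n * p n := mul_nonneg (Nat.cast_nonneg n) (h.pos n).le
  rw [Real.norm_of_nonneg hnp]
  have h1 : (n : ℂ) * ((p n : ℂ) * m n)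
        - ∑ i ∈ Finset.range n, (d (n - i) : ℂ) * ((p i : ℂ) * m i)
      = ∑ i ∈ Finset.range n, (d (n - i) : ℂ) * ((p i : ℂ) * (m n - A - (m i - A))) := by
    have h2 : (n : ℂ) * p n = ∑ i ∈ Finset.range n, (d (n - i) : ℂ) * p i := by
      exact_mod_cast congrArg (fun r : ℝ => (r : ℂ)) (h.recurrence n)
    rw [← mul_assoc, h2, Finset.sum_mul, ← Finset.sum_sub_distrib]
    exact Finset.sum_congr rfl fun i _ => by ring
  have h3 : ∑ i ∈ Finset.range n, p i * w i = ∑ i ∈ Finset.range N, p i * w i := by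
    refine (Finset.sum_subset (Finset.range_mono hn) fun i _ hi => ?_).symm
    rw [Finset.mem_range] at hi
    simp [hw, hi]
  have h4 := h.sum_mul_le n fun i _ => hw0 i
  rw [h3, ← hK] at h4
  have h5 : ∑ i ∈ Finset.range n, d (n - i) * (p i * (ε / 3 + (w i + ε / 3)))
      = 2 * (ε / 3) * (n * p n) + ∑ i ∈ Finset.range n, d (n - i) * (p i * w i) := by
    rw [h.recurrence, Finset.mul_sum, ← Finset.sum_add_distrib]
    exact Finset.sum_congr rfl fun i _ => by ring
  have h6 : ‖∑ i ∈ Finset.range n, (d (n - i) : ℂ) * ((p i : ℂ) * (m n - A - (m i - A)))‖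
      ≤ ∑ i ∈ Finset.range n, d (n - i) * (p i * (ε / 3 + (w i + ε / 3))) := by
    refine norm_sum_le_of_le _ fun i hi => ?_
    have hi := Finset.mem_range.mp hi
    have hd : 0 ≤ d (n - i) := h.lower_pos.le.trans (h.lower_le _ (by omega))
    rw [norm_mul, norm_mul, Complex.norm_real, Complex.norm_real, Real.norm_of_nonneg hd,
      Real.norm_of_nonneg (h.pos i).le]
    refine mul_le_mul_of_nonneg_left (mul_le_mul_of_nonneg_left ?_ (h.pos i).le) hd
    have := hN n hn
    rw [dist_eq_norm] at this
    exact (norm_sub_le _ _).trans (add_le_add this.le (hmw i))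
  rw [h1]
  linarith

theorem tendsto_of_isLittleO_complex (h : IsWeightSystem d p dm dp) {m : ℕ → ℂ} {F : ℝ → ℂ} {A : ℂ}
    (hsum : ∀ x : ℝ, 0 ≤ x → x < 1 →
      HasSum (fun k => (p k : ℂ) * m k * (x : ℂ) ^ k) (F x * (∑' k, p k * x ^ k : ℝ)))
    (hF : Tendsto F (𝓝[<] 1) (𝓝 A))
    (hs : (fun n : ℕ => (n : ℂ) * ((p n : ℂ) * m n)
        - ∑ i ∈ Finset.range n, (d (n - i) : ℂ) * ((p i : ℂ) * m i))
      =o[atTop] fun n : ℕ => (n : ℝ) * p n) :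
    Tendsto m atTop (𝓝 A) := by
  have hre : Tendsto (fun n => (m n).re) atTop (𝓝 A.re) := by
    refine h.tendsto_of_isLittleO (F := fun x => (F x).re) (fun x h0 h1 => ?_)
      ((Complex.continuous_re.tendsto A).comp hF)
      (IsBigO.trans_isLittleO (IsBigO.of_norm_le (g := fun n => ‖_‖) fun n => ?_) hs.norm_left)
    · have := Complex.hasSum_re (hsum x h0 h1)
      rw [Complex.re_mul_ofReal] at this
      convert! this using 1
      ext k
      rw [← Complex.ofReal_pow, Complex.re_mul_ofReal, Complex.re_ofReal_mul]
    · refine le_trans (le_of_eq ?_) (Complex.abs_re_le_norm _)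
      rw [Real.norm_eq_abs, Complex.sub_re, ← Complex.ofReal_natCast, Complex.re_ofReal_mul,
        Complex.re_ofReal_mul, Complex.re_sum]
      simp only [Complex.re_ofReal_mul]
  have him : Tendsto (fun n => (m n).im) atTop (𝓝 A.im) := by
    refine h.tendsto_of_isLittleO (F := fun x => (F x).im) (fun x h0 h1 => ?_)
      ((Complex.continuous_im.tendsto A).comp hF)
      (IsBigO.trans_isLittleO (IsBigO.of_norm_le (g := fun n => ‖_‖) fun n => ?_) hs.norm_left)
    · have := Complex.hasSum_im (hsum x h0 h1)
      rw [Complex.im_mul_ofReal] at this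
      convert! this using 1
      ext k
      rw [← Complex.ofReal_pow, Complex.im_mul_ofReal, Complex.im_ofReal_mul]
    · refine le_trans (le_of_eq ?_) (Complex.abs_im_le_norm _)
      rw [Real.norm_eq_abs, Complex.sub_im, ← Complex.ofReal_natCast, Complex.im_ofReal_mul,
        Complex.im_ofReal_mul, Complex.im_sum]
      simp only [Complex.im_ofReal_mul]
  have := ((Complex.continuous_ofReal.tendsto _).comp hre).add
    (((Complex.continuous_ofReal.tendsto _).comp him).mul_const Complex.I)
  simpa [Function.comp_def] using this

/-- Coefficient form of `D · (f p) = f · (z p')`. -/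
theorem sum_convolution (h : IsWeightSystem d p dm dp) (a : ℕ → ℂ) (n : ℕ) :
    ∑ i ∈ Finset.range n, (d (n - i) : ℂ) * ∑ k ∈ Finset.range (i + 1), a k * (p (i - k) : ℂ)
      = ∑ i ∈ Finset.range n, a i * ((n - i : ℕ) * (p (n - i) : ℂ)) := by
  have h1 := Finset.sum_range_diag_flip n fun i j => (d (n - (i + j)) : ℂ) * (a i * (p j : ℂ))
  calc _ = _ := Finset.sum_congr rfl fun i _ => by
        rw [Finset.mul_sum]
        refine Finset.sum_congr rfl fun k hk => ?_
        have hk := Finset.mem_range.mp hk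
        rw [show k + (i - k) = i by omega]
    _ = _ := h1
    _ = _ := Finset.sum_congr rfl fun i _ => by
        have h2 : ((n - i : ℕ) : ℂ) * (p (n - i) : ℂ)
            = ∑ k ∈ Finset.range (n - i), (d (n - i - k) : ℂ) * p k := by
          exact_mod_cast congrArg (fun r : ℝ => (r : ℂ)) (h.recurrence (n - i))
        rw [h2, Finset.mul_sum]
        refine Finset.sum_congr rfl fun k _ => ?_
        rw [Nat.sub_sub]
        ring

end IsWeightSystem

/-! ### Identities for Voronoi means and the conclusion. -/

theorem weight_mul_voronoiMean {d : ℕ → ℝ} {n : ℕ} (hn : 0 < voronoiWeight d n) (a : ℕ → ℂ) :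
    (voronoiWeight d n : ℂ) * voronoiMean d a n
      = ∑ k ∈ Finset.range (n + 1), a k * (voronoiWeight d (n - k) : ℂ) := by
  rw [voronoiMean, ← mul_assoc, mul_one_div_cancel (by exact_mod_cast hn.ne'), one_mul]

/-- Coefficient form of `z f' p = z (f p)' - D f p`. -/
theorem voronoiS_eq {d : ℕ → ℝ} {dm dp : ℝ} (h : IsWeightSystem d (voronoiWeight d) dm dp)
    (a : ℕ → ℂ) (n : ℕ) :
    voronoiS d a n = (n : ℂ) * ((voronoiWeight d n : ℂ) * voronoiMean d a n)
      - ∑ i ∈ Finset.range n,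
        (d (n - i) : ℂ) * ((voronoiWeight d i : ℂ) * voronoiMean d a i) := by
  simp only [weight_mul_voronoiMean (h.pos _)]
  rw [h.sum_convolution, voronoiS]
  have h1 : ∑ i ∈ Finset.range n, a i * ((n - i : ℕ) * (voronoiWeight d (n - i) : ℂ))
      = ∑ i ∈ Finset.range (n + 1), a i * ((n - i : ℕ) * (voronoiWeight d (n - i) : ℂ)) := by
    simp [Finset.sum_range_succ]
  have h2 : ∑ k ∈ Finset.Icc 1 n, a k * (k : ℂ) * (voronoiWeight d (n - k) : ℂ)
      = ∑ k ∈ Finset.range (n + 1), a k * (k : ℂ) * (voronoiWeight d (n - k) : ℂ) := by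
    refine Finset.sum_subset (fun k hk => ?_) fun k hk hk' => ?_
    · have := Finset.mem_Icc.mp hk
      exact Finset.mem_range.mpr (by omega)
    · have h3 := Finset.mem_range.mp hk
      have : k = 0 := by
        by_contra h0
        exact hk' (Finset.mem_Icc.mpr ⟨by omega, by omega⟩)
      simp [this]
  rw [h1, h2, Finset.mul_sum, ← Finset.sum_sub_distrib]
  refine Finset.sum_congr rfl fun k hk => ?_
  have hk := Finset.mem_range.mp hk
  rw [Nat.cast_sub (by omega)]
  ring

theorem hasSum_voronoiMean {d : ℕ → ℝ} {dm dp : ℝ}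
    (h : IsWeightSystem d (voronoiWeight d) dm dp) {a : ℕ → ℂ} {f : ℂ → ℂ}
    (hf : ∀ z : ℂ, ‖z‖ < 1 → HasSum (fun n : ℕ => a n * z ^ n) (f z)) {x : ℝ} (h0 : 0 ≤ x)
    (h1 : x < 1) :
    HasSum (fun k => (voronoiWeight d k : ℂ) * voronoiMean d a k * (x : ℂ) ^ k)
      (f x * (∑' k, voronoiWeight d k * x ^ k : ℝ)) := by
  have hx : ‖(x : ℂ)‖ < 1 := by rwa [Complex.norm_real, Real.norm_of_nonneg h0]
  have ha := (hf x hx).summable.norm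
  have hp : HasSum (fun k => ((voronoiWeight d k * x ^ k : ℝ) : ℂ))
      ((∑' k, voronoiWeight d k * x ^ k : ℝ) : ℂ) :=
    Complex.hasSum_ofReal.mpr (h.summable h0 h1).hasSum
  have h2 := hasSum_sum_range_mul_of_summable_norm ha hp.summable.norm
  rw [(hf x hx).tsum_eq, hp.tsum_eq] at h2
  convert! h2 using 1
  ext n
  rw [weight_mul_voronoiMean (h.pos _), Finset.sum_mul]
  refine Finset.sum_congr rfl fun k hk => ?_
  have hk := Finset.mem_range.mp hk
  have h3 : (x : ℂ) ^ n = x ^ k * x ^ (n - k) := by rw [← pow_add]; congr 1; omega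
  rw [h3]
  push_cast
  ring

theorem mainTheorem2 (d : ℕ → ℝ) (dminus dplus : ℝ) (hdminus : 0 < dminus)
    (hd : ∀ j : ℕ, 1 ≤ j → dminus < d j ∧ d j < dplus)
    (a : ℕ → ℂ) (f : ℂ → ℂ)
    (hf : ∀ z : ℂ, ‖z‖ < 1 → HasSum (fun n : ℕ => a n * z ^ n) (f z))
    (A : ℂ) :
    Tendsto (fun n : ℕ => voronoiMean d a n) atTop (𝓝 A) ↔
      Tendsto (fun x : ℝ => f (x : ℂ)) (𝓝[<] (1 : ℝ)) (𝓝 A) ∧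
        (fun n : ℕ => voronoiS d a n) =o[atTop]
          (fun n : ℕ => (n : ℝ) * voronoiWeight d n) := by
  have h := isWeightSystem_voronoiWeight hdminus hd
  have hsum := fun (x : ℝ) (h0 : 0 ≤ x) (h1 : x < 1) => hasSum_voronoiMean h hf h0 h1
  simp only [voronoiS_eq h]
  exact ⟨fun hm => ⟨h.tendsto_of_tendsto_mean hsum hm, h.isLittleO_of_tendsto hm⟩,
    fun ⟨hF, hs⟩ => h.tendsto_of_isLittleO_complex hsum hF hs⟩
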